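/- Let $\alpha,\gamma>0$ (for the 4-dimensional Lagrange top with equal moments of inertia $1,1,1$ and moment of inertia $I_4$ along its axis, $\alpha=2/(1+I_4)$, and $\gamma$ is the strength of the linear potential). The top has the Lie--Poisson phase space $\mathfrak s^*=\{(R_1,R_2,g)\in \operatorname{Im}\mathbb H\times\operatorname{Im}\mathbb H\times\mathbb H\}$ and the Hamiltonian $$H=\tfrac{1+\alpha}{4}(|R_1|^2+|R_2|^2)+\tfrac{1-\alpha}{2}\langle R_1,R_2\rangle+\gamma\operatorname{Re} g .$$ Write $\bar g=\operatorname{Im} g$, $(v_1,v_2,v_3)=(R_1,R_2,\bar g)$, $k_{ij}=\langle v_i,v_j\rangle$, $\delta=\langle R_1\times R_2,\bar g\rangle$, $r=\operatorname{Re} g$. These eight functions identify the quotient of $\mathfrak s^*$ by simultaneous conjugation with unit quaternions with a subset of $\mathbb R^8$ (the set of their joint values). For $\lambda,\rho\in\operatorname{Im}\mathbb H$ the full reduced space $M_{\lambda,\rho}$ is the subset of this set given by $C_1=1$, $C_2=|\lambda|^2$, $C_3=|\rho|^2$, where $C_1=k_{33}+r^2=|g|^2$, $C_2=(k_{33}+r^2)(k_{11}+k_{22})+2k_{12}(r^2-k_{33})+4k_{13}k_{23}-4r\delta=|R_1g+gR_2|^2$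 and $C_3=k_{11}+k_{22}+2k_{12}=|R_1+R_2|^2$. The flow of $H$ descends to the reduced equations of motion $$\dot k_{11}=-2\gamma k_{13},\quad \dot k_{12}=-\gamma(k_{23}-k_{13}),\quad \dot k_{13}=-\gamma k_{33}-\alpha r(k_{11}-k_{12})-\alpha\delta,\quad \dot k_{22}=2\gamma k_{23},$$ $$\dot k_{23}=\gamma k_{33}-\alpha r(k_{12}-k_{22})+\alpha\delta,\quad \dot k_{33}=2\alpha r(k_{23}-k_{13}),\quad \dot r=\alpha(k_{13}-k_{23}),$$ $$\dot\delta=\alpha(k_{12}k_{13}-k_{11}k_{23})+\alpha(k_{13}k_{22}-k_{12}k_{23}).$$ A relative equilibrium in $M_{\lambda,\rho}$ is a point of $M_{\lambda,\rho}$ at which the right-hand sides all vanish. Its angle $\theta\in[0,\pi]$ is given by $r=\cos\theta$, and it is called isosceles if $k_{11}=k_{22}$, that is, $|R_1|=|R_2|$. **Theorem.** For all $\lambda,\rho\in\operatorname{Im}\mathbb H$ the following holds for the relative equilibria in the full reduced space $M_{\lambda,\rho}$ of the 4-dimensional Lagrange top. 1. Every upright relative equilibrium ($\theta<\pi/2$)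 is linearly unstable: the linearisation in $\mathbb R^8$ of the reduced equations of motion at it has an eigenvalue with positive real part, with an eigenvector whose real and imaginary parts are annihilated by the differentials of $C_1$, $C_2$, $C_3$ and $\delta^2-\det(k_{ij})$. 2. Every hanging relative equilibrium ($\theta>\pi/2$), and every horizontal relative equilibrium ($\theta=\pi/2$) that is not isosceles, is Lyapunov stable in $M_{\lambda,\rho}$: for every neighbourhood $U$ of it there is a neighbourhood $W$ of it such that every solution of the reduced equations of motion in $M_{\lambda,\rho}$ that starts in $W$ remains in $U$ for all later times. -/

import Mathlib

open scoped Quaternion Topology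

namespace LagrangeTop

/-! ### The dual of the Lie algebra of the double cover of SE(4) -/

/-- The ambient space `ℍ × ℍ × ℍ` of triples `(R₁, R₂, g)`. -/
abbrev Triple : Type := ℍ[ℝ] × ℍ[ℝ] × ℍ[ℝ]

/-- The dual `𝔰* = Im ℍ × Im ℍ × ℍ` : triples `(R₁, R₂, g)` with `R₁`, `R₂` purely imaginary. -/
def dualSpace : Set Triple := {z | z.1.re = 0 ∧ z.2.1.re = 0}

/-- Cross product of imaginary quaternions, `v × w = (v w - w v) / 2`. -/
noncomputable def cross (v w : ℍ[ℝ]) : ℍ[ℝ] := (2⁻¹ : ℝ) • (v * w - w * v)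

/-- Gradients of a function on `𝔰*` in the three factors (the first two take values in `Im ℍ`). -/
noncomputable def grad1 (f : Triple → ℝ) (z : Triple) : ℍ[ℝ] :=
  (gradient (fun v => f (v, z.2.1, z.2.2)) z.1).im

noncomputable def grad2 (f : Triple → ℝ) (z : Triple) : ℍ[ℝ] :=
  (gradient (fun v => f (z.1, v, z.2.2)) z.2.1).im

noncomputable def grad3 (f : Triple → ℝ) (z : Triple) : ℍ[ℝ] :=
  gradient (fun v => f (z.1, z.2.1, v)) z.2.2

/-- The Lie-Poisson bracket `{f, h}` on `𝔰*`. Convention for the flow of `H`: `ḟ = {H, f}`. -/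
noncomputable def lieBracket (f h : Triple → ℝ) (z : Triple) : ℝ :=
  inner ℝ z.1 (grad1 f z * grad1 h z - grad1 h z * grad1 f z)
  + inner ℝ z.2.1 (grad2 f z * grad2 h z - grad2 h z * grad2 f z)
  + inner ℝ z.2.2 ((grad1 f z * grad3 h z - grad3 h z * grad2 f z)
      - (grad1 h z * grad3 f z - grad3 f z * grad2 h z))

/-- The Hamiltonian of the 4-dimensional Lagrange top on `𝔰*`. -/
noncomputable def topHamiltonian (α γ : ℝ) (z : Triple) : ℝ :=
  (1 + α) / 4 * (inner ℝ z.1 z.1 + inner ℝ z.2.1 z.2.1)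
    + (1 - α) / 2 * inner ℝ z.1 z.2.1 + γ * z.2.2.re

/-! ### The full reduced spaces -/

/-- Coordinates `(k₁₁, k₁₂, k₁₃, k₂₂, k₂₃, k₃₃, r, δ)`. -/
abbrev Coord : Type := Fin 8 → ℝ

/-- The Hilbert map: the generators of the invariants of the simultaneous conjugation
`(R₁, R₂, g) ↦ (q R₁ q⁻¹, q R₂ q⁻¹, q g q⁻¹)` by unit quaternions `q`. -/
noncomputable def hilbertMap (z : Triple) : Coord :=
  ![inner ℝ z.1 z.1, inner ℝ z.1 z.2.1, inner ℝ z.1 z.2.2.im,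
    inner ℝ z.2.1 z.2.1, inner ℝ z.2.1 z.2.2.im, inner ℝ z.2.2.im z.2.2.im,
    z.2.2.re, inner ℝ (cross z.1 z.2.1) z.2.2.im]

/-- The orbit space of `𝔰*` under simultaneous conjugation, as the image of the Hilbert map. -/
noncomputable def poissonReducedSpace : Set Coord := hilbertMap '' dualSpace

def k11 (x : Coord) : ℝ := x 0
def k12 (x : Coord) : ℝ := x 1
def k13 (x : Coord) : ℝ := x 2
def k22 (x : Coord) : ℝ := x 3
def k23 (x : Coord) : ℝ := x 4
def k33 (x : Coord) : ℝ := x 5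
def rr (x : Coord) : ℝ := x 6
def del (x : Coord) : ℝ := x 7

/-- The three Casimirs. -/
def C1 (x : Coord) : ℝ := k33 x + rr x ^ 2

def C2 (x : Coord) : ℝ :=
  (k33 x + rr x ^ 2) * (k11 x + k22 x) + 2 * k12 x * (rr x ^ 2 - k33 x)
    + 4 * k13 x * k23 x - 4 * rr x * del x

def C3 (x : Coord) : ℝ := k11 x + k22 x + 2 * k12 x

/-- The Gram relation `δ² - det (kᵢⱼ)`, which vanishes on the Poisson reduced space. -/
def gramRelation (x : Coord) : ℝ :=
  del x ^ 2 - Matrix.det !![k11 x, k12 x, k13 x; k12 x, k22 x, k23 x; k13 x, k23 x, k33 x]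

/-- The full reduced space with left and right momenta `lam` and `rho`. -/
def fullReducedSpace (lam rho : ℍ[ℝ]) : Set Coord :=
  {x | x ∈ poissonReducedSpace ∧ C1 x = 1 ∧ C2 x = ‖lam‖ ^ 2 ∧ C3 x = ‖rho‖ ^ 2}

/-! ### The reduced dynamics -/

/-- The full reduced equations of motion of the Lagrange top. -/
def reducedField (α γ : ℝ) (x : Coord) : Coord :=
  ![-2 * γ * k13 x,
    -γ * (k23 x - k13 x),
    -γ * k33 x - α * rr x * (k11 x - k12 x) - α * del x,
    2 * γ * k23 x,
    γ * k33 x - α * rr x * (k12 x - k22 x) + α * del x,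
    2 * α * rr x * (k23 x - k13 x),
    α * (k13 x - k23 x),
    α * (k12 x * k13 x - k11 x * k23 x) + α * (k13 x * k22 x - k12 x * k23 x)]

/-- A relative equilibrium in the full reduced space: a fixed point of the reduced flow. -/
def IsRelativeEquilibrium (α γ : ℝ) (lam rho : ℍ[ℝ]) (x : Coord) : Prop :=
  x ∈ fullReducedSpace lam rho ∧ reducedField α γ x = 0

/-- The angle `θ ∈ [0, π]` between the body axis and the vertical, `r = cos θ`. -/
noncomputable def theta (x : Coord) : ℝ := Real.arccos (rr x)

/-- The relative equilibrium is isosceles: `|R₁| = |R₂|`. -/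
def IsIsosceles (x : Coord) : Prop := k11 x = k22 x

/-! ### Stability notions -/

/-- The linearisation of the reduced equations of motion at `x`, an `8 × 8` matrix. -/
noncomputable def linearization (α γ : ℝ) (x : Coord) : Matrix (Fin 8) (Fin 8) ℝ :=
  LinearMap.toMatrix' (fderiv ℝ (reducedField α γ) x : Coord →ₗ[ℝ] Coord)

/-- The (Zariski) tangent space at `x` of the full reduced space through `x`: the vectors
annihilated by the differentials of the Casimirs and of the Gram relation. -/
noncomputable def tangentSpace (x : Coord) : Submodule ℝ Coord :=
  LinearMap.ker (fderiv ℝ C1 x : Coord →ₗ[ℝ] ℝ) ⊓ LinearMap.ker (fderiv ℝ C2 x : Coord →ₗ[ℝ] ℝ)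
    ⊓ LinearMap.ker (fderiv ℝ C3 x : Coord →ₗ[ℝ] ℝ)
    ⊓ LinearMap.ker (fderiv ℝ gramRelation x : Coord →ₗ[ℝ] ℝ)

/-- Linear instability: the linearisation has an eigenvalue of positive real part, with an
eigenvector in the complexified tangent space of the full reduced space. -/
def LinearlyUnstable (α γ : ℝ) (x : Coord) : Prop :=
  ∃ (μ : ℂ) (v : Fin 8 → ℂ), 0 < μ.re ∧
    Module.End.HasEigenvector
      (Matrix.toLin' ((linearization α γ x).map (fun a : ℝ => (a : ℂ)))) μ v ∧
    (fun i => (v i).re) ∈ tangentSpace x ∧ (fun i => (v i).im) ∈ tangentSpace x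

/-- `c` is a motion of the reduced system in the full reduced space, for times in `[0, T]`. -/
def IsMotion (α γ : ℝ) (lam rho : ℍ[ℝ]) (T : ℝ) (c : ℝ → Coord) : Prop :=
  ∀ t ∈ Set.Icc 0 T, c t ∈ fullReducedSpace lam rho ∧
    HasDerivWithinAt c (reducedField α γ (c t)) (Set.Icc 0 T) t

/-- Lyapunov stability in the full reduced space: for each neighbourhood `U` of `x` there is a
neighbourhood `W` of `x` such that every motion in the full reduced space that starts in `W`
stays in `U`, on every time interval `[0, T]` on which it is defined. -/
def LyapunovStable (α γ : ℝ) (lam rho : ℍ[ℝ]) (x : Coord) : Prop :=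
  ∀ U ∈ 𝓝 x, ∃ W ∈ 𝓝 x, ∀ (T : ℝ) (c : ℝ → Coord),
    0 ≤ T → IsMotion α γ lam rho T c → c 0 ∈ W → ∀ t ∈ Set.Icc 0 T, c t ∈ U

/-! ### Consistency of the definitions -/

theorem casimirs_hilbertMap {R₁ R₂ g : ℍ[ℝ]} (h₁ : R₁.re = 0) (h₂ : R₂.re = 0) :
    C1 (hilbertMap (R₁, R₂, g)) = ‖g‖ ^ 2 ∧
    C2 (hilbertMap (R₁, R₂, g)) = ‖R₁ * g + g * R₂‖ ^ 2 ∧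
    C3 (hilbertMap (R₁, R₂, g)) = ‖R₁ + R₂‖ ^ 2 := by
  simp only [← real_inner_self_eq_norm_sq, C1, C2, C3, hilbertMap, k11, k12, k13, k22, k23,
    k33, rr, del, Quaternion.inner_def]
  refine ⟨?_, ?_, ?_⟩ <;> simp [cross, h₁, h₂] <;> ring

/-- In terms of the phase space `T*(S³ × S³)`, with points `(g₁, p₁, g₂, p₂)`, the full reduced
space is the set of orbits of the points whose left and right momenta lie in the coadjoint orbits
(spheres) through `lam` and `rho`. -/
theorem mem_fullReducedSpace_iff (lam rho : ℍ[ℝ]) (x : Coord) :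
    x ∈ fullReducedSpace lam rho ↔ ∃ g₁ p₁ g₂ p₂ : ℍ[ℝ],
      ‖g₁‖ = 1 ∧ ‖g₂‖ = 1 ∧ inner ℝ p₁ g₁ = 0 ∧ inner ℝ p₂ g₂ = 0 ∧
      ‖p₁ * g₁⁻¹ + p₂ * g₂⁻¹‖ = ‖lam‖ ∧ ‖g₁⁻¹ * p₁ + g₂⁻¹ * p₂‖ = ‖rho‖ ∧
      x = hilbertMap (g₁⁻¹ * p₁, g₂⁻¹ * p₂, g₁⁻¹ * g₂) := by
  have hinv : ∀ q : ℍ[ℝ], ‖q‖ = 1 → q⁻¹ = star q := by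
    intro q hq
    rw [Quaternion.inv_def, Quaternion.normSq_eq_norm_mul_self, hq]
    simp
  have hne : ∀ q : ℍ[ℝ], ‖q‖ = 1 → q ≠ 0 := by
    intro q hq h0
    simp [h0] at hq
  have sq : ∀ a b : ℍ[ℝ], ‖a‖ ^ 2 = ‖b‖ ^ 2 → ‖a‖ = ‖b‖ := fun a b h =>
    (sq_eq_sq₀ (norm_nonneg _) (norm_nonneg _)).1 h
  constructor
  · rintro ⟨⟨⟨R₁, R₂, g⟩, ⟨h₁, h₂⟩, rfl⟩, hC1, hC2, hC3⟩
    simp only at h₁ h₂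
    obtain ⟨e1, e2, e3⟩ := casimirs_hilbertMap (g := g) h₁ h₂
    rw [e1] at hC1
    rw [e2] at hC2
    rw [e3] at hC3
    have hg : ‖g‖ = 1 := by
      have := norm_nonneg g
      nlinarith
    have g0 := hne g hg
    refine ⟨1, R₁, g, g * R₂, by simp, hg, by simp [Quaternion.inner_def, h₁], ?_, ?_, ?_, ?_⟩
    · simp [Quaternion.inner_def, h₂]
      ring
    · rw [← sq _ _ hC2]
      have : R₁ * 1⁻¹ + g * R₂ * g⁻¹ = (R₁ * g + g * R₂) * g⁻¹ := by
        rw [add_mul, mul_assoc R₁, mul_inv_cancel₀ g0]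
        simp
      rw [this, norm_mul, norm_inv, hg]
      simp
    · rw [← sq _ _ hC3, ← mul_assoc, inv_mul_cancel₀ g0]
      simp
    · rw [← mul_assoc, inv_mul_cancel₀ g0]
      simp
  · rintro ⟨g₁, p₁, g₂, p₂, hg₁, hg₂, hp₁, hp₂, hL, hR, rfl⟩
    have n₁ := hne g₁ hg₁
    have n₂ := hne g₂ hg₂
    have r₁ : (g₁⁻¹ * p₁).re = 0 := by
      rw [hinv g₁ hg₁]
      refine Eq.trans ?_ hp₁
      simp [Quaternion.inner_def]
      ring
    have r₂ : (g₂⁻¹ * p₂).re = 0 := by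
      rw [hinv g₂ hg₂]
      refine Eq.trans ?_ hp₂
      simp [Quaternion.inner_def]
      ring
    obtain ⟨e1, e2, e3⟩ := casimirs_hilbertMap (g := g₁⁻¹ * g₂) r₁ r₂
    refine ⟨⟨_, ⟨r₁, r₂⟩, rfl⟩, ?_, ?_, ?_⟩
    · rw [e1, norm_mul, norm_inv, hg₁, hg₂]
      simp
    · have : g₁⁻¹ * p₁ * (g₁⁻¹ * g₂) + g₁⁻¹ * g₂ * (g₂⁻¹ * p₂)
          = g₁⁻¹ * (p₁ * g₁⁻¹ + p₂ * g₂⁻¹) * g₂ := by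
        have a : g₂ * (g₂⁻¹ * p₂) = p₂ * (g₂⁻¹ * g₂) := by
          rw [inv_mul_cancel₀ n₂, ← mul_assoc, mul_inv_cancel₀ n₂]
          simp
        rw [mul_assoc g₁⁻¹ g₂, a]
        noncomm_ring
      rw [e2, this, norm_mul, norm_mul, norm_inv, hg₁, hg₂, hL]
      simp
    · rw [e3, hR]

theorem gradient_eq_of {f : ℍ[ℝ] → ℝ} (b c : ℝ) (a v : ℍ[ℝ])
    (h : ∀ w, f w = b + inner ℝ a w + c * inner ℝ w w) :
    gradient f v = a + (2 * c) • v := by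
  apply HasGradientAt.gradient
  rw [hasGradientAt_iff_hasFDerivAt, funext h]
  have h1 := ((InnerProductSpace.toDual ℝ ℍ[ℝ] a).hasFDerivAt (x := v)).const_add b
  have h2 := ((hasFDerivAt_id (𝕜 := ℝ) v).inner ℝ (hasFDerivAt_id v)).const_mul c
  refine (h1.add h2).congr_fderiv ?_
  ext w
  simp [InnerProductSpace.toDual_apply_apply, real_inner_comm w v]
  ring

theorem gradient_eq_of_im {f : ℍ[ℝ] → ℝ} (b c : ℝ) (a v : ℍ[ℝ])
    (h : ∀ w, f w = b + inner ℝ a w + c * inner ℝ w.im w.im) :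
    gradient f v = a + (2 * c) • v.im := by
  apply HasGradientAt.gradient
  rw [hasGradientAt_iff_hasFDerivAt]
  have e : f = fun w => (b + inner ℝ a w) + c * (inner ℝ w w - inner ℝ 1 w * inner ℝ 1 w) := by
    funext w
    rw [h w]
    have e1 : inner ℝ w.im w.im = inner ℝ w w - inner ℝ 1 w * inner ℝ 1 w := by
      simp only [Quaternion.inner_def, Quaternion.re_mul]
      simp
      ring
    rw [e1]
  rw [e]
  have h1 := ((InnerProductSpace.toDual ℝ ℍ[ℝ] a).hasFDerivAt (x := v)).const_add b
  have h0 := (InnerProductSpace.toDual ℝ ℍ[ℝ] 1).hasFDerivAt (x := v)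
  have h2 := (((hasFDerivAt_id (𝕜 := ℝ) v).inner ℝ (hasFDerivAt_id v)).sub
    (h0.mul h0)).const_mul c
  refine (h1.add h2).congr_fderiv ?_
  ext w
  simp [InnerProductSpace.toDual_apply_apply, Quaternion.inner_def]
  ring

theorem lieBracket_topHamiltonian (α γ : ℝ) {f : Triple → ℝ} {u v g : ℍ[ℝ]}
    (hu : u.re = 0) (hv : v.re = 0) (b₁ b₂ b₃ c₁ c₂ c₃ : ℝ) (a₁ a₂ a₃ : ℍ[ℝ])
    (h1 : ∀ w, f (w, v, g) = b₁ + inner ℝ a₁ w + c₁ * inner ℝ w w)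
    (h2 : ∀ w, f (u, w, g) = b₂ + inner ℝ a₂ w + c₂ * inner ℝ w w)
    (h3 : ∀ w, f (u, v, w) = b₃ + inner ℝ a₃ w + c₃ * inner ℝ w.im w.im) :
    lieBracket (topHamiltonian α γ) f (u, v, g) =
      inner ℝ u (((1 - α) / 2) • (v * (a₁ + (2 * c₁) • u).im - (a₁ + (2 * c₁) • u).im * v))
      + inner ℝ v (((1 - α) / 2) • (u * (a₂ + (2 * c₂) • v).im - (a₂ + (2 * c₂) • v).im * u))
      + inner ℝ g ((((1 + α) / 2) • u + ((1 - α) / 2) • v) * (a₃ + (2 * c₃) • g.im)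
        - (a₃ + (2 * c₃) • g.im) * (((1 + α) / 2) • v + ((1 - α) / 2) • u)
        - γ • ((a₁ + (2 * c₁) • u).im - (a₂ + (2 * c₂) • v).im)) := by
  have H1 : grad1 (topHamiltonian α γ) (u, v, g)
      = (((1 - α) / 2) • v + (2 * ((1 + α) / 4)) • u).im := by
    unfold grad1
    rw [gradient_eq_of ((1 + α) / 4 * inner ℝ v v + γ * g.re) ((1 + α) / 4)
      (((1 - α) / 2) • v) u]
    intro w
    simp only [topHamiltonian, inner_smul_left, real_inner_comm w v, conj_trivial]
    ring
  have H2 : grad2 (topHamiltonian α γ) (u, v, g)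
      = (((1 - α) / 2) • u + (2 * ((1 + α) / 4)) • v).im := by
    unfold grad2
    rw [gradient_eq_of ((1 + α) / 4 * inner ℝ u u + γ * g.re) ((1 + α) / 4)
      (((1 - α) / 2) • u) v]
    intro w
    simp only [topHamiltonian, inner_smul_left, conj_trivial]
    ring
  have H3 : grad3 (topHamiltonian α γ) (u, v, g) = γ • 1 + (2 * (0 : ℝ)) • g.im := by
    unfold grad3
    rw [gradient_eq_of_im ((1 + α) / 4 * (inner ℝ u u + inner ℝ v v)
      + (1 - α) / 2 * inner ℝ u v) 0 (γ • 1) g]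
    intro w
    simp [topHamiltonian, Quaternion.inner_def]
  have F1 : grad1 f (u, v, g) = (a₁ + (2 * c₁) • u).im := by
    unfold grad1
    rw [gradient_eq_of b₁ c₁ a₁ u h1]
  have F2 : grad2 f (u, v, g) = (a₂ + (2 * c₂) • v).im := by
    unfold grad2
    rw [gradient_eq_of b₂ c₂ a₂ v h2]
  have F3 : grad3 f (u, v, g) = a₃ + (2 * c₃) • g.im := by
    unfold grad3
    rw [gradient_eq_of_im b₃ c₃ a₃ g h3]
  unfold lieBracket
  rw [H1, H2, H3, F1, F2, F3]
  simp only [Quaternion.inner_def]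
  simp [hu, hv]
  ring

set_option maxHeartbeats 4000000 in
/-- The reduced equations of motion are the push-forward, under the Hilbert map, of the
Hamiltonian flow of the Lagrange top on `𝔰*`. -/
theorem lieBracket_hilbertMap (α γ : ℝ) (z : Triple) (hz : z ∈ dualSpace) (i : Fin 8) :
    lieBracket (topHamiltonian α γ) (fun w => hilbertMap w i) z
      = reducedField α γ (hilbertMap z) i := by
  obtain ⟨u, v, g⟩ := z
  obtain ⟨hu, hv⟩ := hz
  simp only at hu hv
  have key := fun (f : Triple → ℝ) => @lieBracket_topHamiltonian α γ f u v g hu hv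
  fin_cases i
  on_goal 1 => refine (key _ 0 (inner ℝ u u) (inner ℝ u u) 1 0 0 0 0 0 ?_ ?_ ?_).trans ?_
  on_goal 5 => refine (key _ 0 0 (inner ℝ u v) 0 0 0 v u 0 ?_ ?_ ?_).trans ?_
  on_goal 9 => refine (key _ 0 (inner ℝ u g.im) 0 0 0 0 g.im 0 u ?_ ?_ ?_).trans ?_
  on_goal 13 => refine (key _ (inner ℝ v v) 0 (inner ℝ v v) 0 1 0 0 0 0 ?_ ?_ ?_).trans ?_
  on_goal 17 => refine (key _ (inner ℝ v g.im) 0 0 0 0 0 0 g.im v ?_ ?_ ?_).trans ?_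
  on_goal 21 => refine (key _ (inner ℝ g.im g.im) (inner ℝ g.im g.im) 0 0 0 1 0 0 0 ?_ ?_ ?_).trans ?_
  on_goal 25 => refine (key _ g.re g.re 0 0 0 0 0 0 1 ?_ ?_ ?_).trans ?_
  on_goal 29 => refine (key _ 0 0 0 0 0 0 (cross v g.im) (cross g.im u) (cross u v) ?_ ?_ ?_).trans ?_
  all_goals try intro w
  all_goals simp only [hilbertMap, reducedField, k11, k12, k13, k22, k23, k33, rr, del,
    Quaternion.inner_def]
  all_goals simp [cross, hu, hv]
  all_goals ring

end LagrangeTop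

/-!
Write `S = R₁ + R₂`, `D = R₁ - R₂`, and use the variables `r`, `P = ⟨S, ḡ⟩ = k₁₃ + k₂₃`,
`E = ⟨D, ḡ⟩ = k₁₃ - k₂₃`, `Y = ⟨S, D⟩ = k₁₁ - k₂₂`, `d = |D|²` and `X = ⟨S, R₁ g + g R₂⟩`.
At a relative equilibrium `P = E = 0` and `r Y = 0`.

*Instability.* The pair `(Y, P)` satisfies `Y' = -2γ P`, `P' = -α r Y`. At an upright equilibrium
these two directions alone span an invariant plane of the linearisation, tangent to the reduced
space, with eigenvalues `± √(2αγr)`; see `linearlyUnstable_of_rr_pos`.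

*Stability.* The energy amounts, on a reduced space, to `γ r - α k₁₂` (`reducedEnergy`), and this
need not have an extremum at a stable equilibrium: there are hanging equilibria at which it is
positive definite in the nutation and negative definite in the other degree of freedom. The top is
integrable, however: `α Y² + 4γ X` is a second integral (`secondIntegral`). An equilibrium that is an
isolated point of the joint level set of the two integrals in the reduced space is Lyapunov
stable, by compactness of small spheres (`lyapunovStable_of_isolated`). Isolation is algebraic.
With `κ = 4γ/α`, the integrals give `d = d₀ - κ (r - r₀)` and `Y² = Y₀² - κ (X - X₀)`, while the
Casimirs and the Gram relation become (`C2_eq`, `C2_mul_C3_sub_sq`)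

* `C₂ = P² - E² - r² C₃ + 2 r X + d (1 - r²)`,
* `C₂ C₃ - X² = P² (C₃ + d) - 2 Y P E + (1 - r²) Y²`.

If `r₀ < 0`, then `Y₀ = 0`, `C₂ C₃ = X₀²`, and with `X₀ - X = Y² / κ` the second relation says that
a quadratic form in `(P, Y)` vanishes. At the equilibrium it is diagonal, with coefficients
`κ (C₃ + d₀)` of `P²` and `-2 r₀ (C₃ + d₀)` of `Y²`, so near it the form is positive definite (unless
`C₃ + d₀ = 0`, a case in which `S = 0` throughout); hence `P = Y = 0` and `X = X₀`. The first
relation then equates `E²` to a cubic in `r` with a double root at `r₀` and negative second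
derivative there, so `E = 0` and `r = r₀` (`isolated_of_hanging`).

If `r₀ = 0`, a combination of the two relations is a positive definite
form in `(E, P)` plus one in `(r, X - X₀)`, the condition being `2 |⟨S, D⟩| < |S|² + |D|²`; then
`Y² = Y₀²`, and `Y = Y₀` because `Y₀ ≠ 0` and `Y` is near `Y₀` (`isolated_of_horizontal`).
-/

namespace LagrangeTop

/-! ### The two integrals of motion -/

/-- The energy on a full reduced space, up to an additive constant: the Hamiltonian equals
`(1 + α) / 4 * C3 + reducedEnergy`. -/
def reducedEnergy (α γ : ℝ) (x : Coord) : ℝ := γ * rr x - α * k12 x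

/-- The inner product `⟨R₁ + R₂, R₁ g + g R₂⟩` of the right momentum with the (conjugated) left
momentum, expressed in the invariants. -/
def momentumPairing (x : Coord) : ℝ := rr x * C3 x - 2 * del x

/-- The second integral of the top, independent of the energy. -/
def secondIntegral (α γ : ℝ) (x : Coord) : ℝ :=
  α * (k11 x - k22 x) ^ 2 + 4 * γ * momentumPairing x

theorem IsMotion.hasDerivWithinAt_apply {α γ : ℝ} {lam rho : ℍ[ℝ]} {T : ℝ} {c : ℝ → Coord}
    (hc : IsMotion α γ lam rho T c) {t : ℝ} (ht : t ∈ Set.Icc 0 T) (i : Fin 8) :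
    HasDerivWithinAt (fun s => c s i) (reducedField α γ (c t) i) (Set.Icc 0 T) t :=
  hasDerivWithinAt_pi.1 (hc t ht).2 i

theorem eq_of_hasDerivWithinAt_zero {T : ℝ} {f : ℝ → ℝ}
    (hf : ∀ t ∈ Set.Icc 0 T, HasDerivWithinAt f 0 (Set.Icc 0 T) t) {t : ℝ}
    (ht : t ∈ Set.Icc 0 T) : f t = f 0 := by
  refine constant_of_has_deriv_right_zero (fun s hs => (hf s hs).continuousWithinAt)
    (fun s hs => ?_) t ht
  exact (hf s ⟨hs.1, hs.2.le⟩).mono_of_mem_nhdsWithin (Icc_mem_nhdsGE_of_mem hs)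

theorem IsMotion.reducedEnergy_eq {α γ : ℝ} {lam rho : ℍ[ℝ]} {T : ℝ} {c : ℝ → Coord}
    (hc : IsMotion α γ lam rho T c) {t : ℝ} (ht : t ∈ Set.Icc 0 T) :
    reducedEnergy α γ (c t) = reducedEnergy α γ (c 0) := by
  refine eq_of_hasDerivWithinAt_zero (f := fun t => reducedEnergy α γ (c t)) (fun s hs => ?_) ht
  have h := hc.hasDerivWithinAt_apply hs
  refine (((h 6).const_mul γ).sub ((h 1).const_mul α)).congr_deriv ?_
  simp [reducedField]
  ring

theorem IsMotion.secondIntegral_eq {α γ : ℝ} {lam rho : ℍ[ℝ]} {T : ℝ} {c : ℝ → Coord}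
    (hc : IsMotion α γ lam rho T c) {t : ℝ} (ht : t ∈ Set.Icc 0 T) :
    secondIntegral α γ (c t) = secondIntegral α γ (c 0) := by
  refine eq_of_hasDerivWithinAt_zero (f := fun t => secondIntegral α γ (c t)) (fun s hs => ?_) ht
  have h := hc.hasDerivWithinAt_apply hs
  refine (((((h 0).sub (h 3)).pow 2).const_mul α).add
    ((((h 6).mul (((h 0).add (h 3)).add ((h 1).const_mul 2))).sub
      ((h 7).const_mul 2)).const_mul (4 * γ))).congr_deriv ?_
  simp [reducedField, k11, k12, k13, k22, k23, k33, rr, del]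
  ring

/-! ### Lyapunov stability from isolation in a level set -/

/-- A closed set containing the full reduced space with squared momenta `a = |λ|²` and `b = |ρ|²`:
the Casimirs and the Gram relation are imposed, and only those consequences of the Cauchy-Schwarz
inequality that the isolation arguments need. -/
def closedHull (a b : ℝ) : Set Coord :=
  {x | C1 x = 1 ∧ C2 x = a ∧ C3 x = b ∧ gramRelation x = 0 ∧
    0 ≤ k11 x + k22 x - 2 * k12 x ∧ (k13 x + k23 x) ^ 2 ≤ C3 x * k33 x ∧
    (k11 x - k22 x) ^ 2 ≤ C3 x * (k11 x + k22 x - 2 * k12 x)}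

theorem isClosed_closedHull (a b : ℝ) : IsClosed (closedHull a b) := by
  have h (i : Fin 8) : Continuous fun x : Coord => x i := continuous_apply i
  simp only [closedHull, Set.ofPred_and, C1, C2, C3, gramRelation, Matrix.det_fin_three, k11, k12,
    k13, k22, k23, k33, rr, del, Matrix.of_apply, Matrix.cons_val]
  refine (isClosed_eq ?_ ?_).inter <| (isClosed_eq ?_ ?_).inter <| (isClosed_eq ?_ ?_).inter <|
    (isClosed_eq ?_ ?_).inter <| (isClosed_le ?_ ?_).inter <| (isClosed_le ?_ ?_).inter <|
    isClosed_le ?_ ?_ <;> fun_prop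

theorem gramRelation_hilbertMap {z : Triple} (hz : z ∈ dualSpace) :
    gramRelation (hilbertMap z) = 0 := by
  obtain ⟨u, v, g⟩ := z
  obtain ⟨hu, hv⟩ := hz
  simp only at hu hv
  simp only [gramRelation, Matrix.det_fin_three, hilbertMap, k11, k12, k13, k22, k23, k33, del,
    Quaternion.inner_def]
  simp [cross, hu, hv]
  ring

theorem fullReducedSpace_subset_closedHull (lam rho : ℍ[ℝ]) :
    fullReducedSpace lam rho ⊆ closedHull (‖lam‖ ^ 2) (‖rho‖ ^ 2) := by
  rintro _ ⟨⟨⟨u, v, g⟩, hz, rfl⟩, h1, h2, h3⟩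
  have e3 : C3 (hilbertMap (u, v, g)) = inner ℝ (u + v) (u + v) := by
    simp only [C3, hilbertMap, k11, k12, k22, Matrix.cons_val, inner_add_left, inner_add_right,
      real_inner_comm u v]
    ring
  have ed : k11 (hilbertMap (u, v, g)) + k22 (hilbertMap (u, v, g))
      - 2 * k12 (hilbertMap (u, v, g)) = inner ℝ (u - v) (u - v) := by
    simp only [hilbertMap, k11, k12, k22, Matrix.cons_val, inner_sub_left, inner_sub_right,
      real_inner_comm u v]
    ring
  have eP : k13 (hilbertMap (u, v, g)) + k23 (hilbertMap (u, v, g)) = inner ℝ (u + v) g.im := by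
    simp [hilbertMap, k13, k23, inner_add_left]
  have eY : k11 (hilbertMap (u, v, g)) - k22 (hilbertMap (u, v, g))
      = inner ℝ (u + v) (u - v) := by
    simp only [hilbertMap, k11, k22, Matrix.cons_val, inner_add_left, inner_sub_right,
      real_inner_comm u v]
    ring
  refine ⟨h1, h2, h3, gramRelation_hilbertMap hz, ?_, ?_, ?_⟩
  · rw [ed]
    exact real_inner_self_nonneg
  · rw [eP, e3, sq]
    exact real_inner_mul_inner_self_le _ _
  · rw [eY, e3, ed, sq]
    exact real_inner_mul_inner_self_le _ _

/-- On a small sphere around `x` the sum of the squared deviations of the two integrals is bounded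
below on the reduced space, so no motion starting close enough to `x` crosses the sphere. -/
theorem lyapunovStable_of_isolated {α γ : ℝ} {lam rho : ℍ[ℝ]} {x : Coord}
    (h : ∀ᶠ y in 𝓝 x, y ∈ closedHull (‖lam‖ ^ 2) (‖rho‖ ^ 2) →
      reducedEnergy α γ y = reducedEnergy α γ x → secondIntegral α γ y = secondIntegral α γ x →
      y = x) :
    LyapunovStable α γ lam rho x := by
  intro U hU
  obtain ⟨ε, hε, hball⟩ := Metric.nhds_basis_closedBall.mem_iff.1 (Filter.inter_mem hU h)
  set G : Coord → ℝ := fun y => (reducedEnergy α γ y - reducedEnergy α γ x) ^ 2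
    + (secondIntegral α γ y - secondIntegral α γ x) ^ 2 with hG
  have hGc : Continuous G := by
    have h (i : Fin 8) : Continuous fun x : Coord => x i := continuous_apply i
    simp only [hG, reducedEnergy, secondIntegral, momentumPairing, C3, k11, k12, k22, rr, del]
    fun_prop
  have hcomp : IsCompact (Metric.sphere x ε ∩ closedHull (‖lam‖ ^ 2) (‖rho‖ ^ 2)) :=
    (isCompact_sphere x ε).inter_right (isClosed_closedHull _ _)
  obtain ⟨m, hm, hmG⟩ : ∃ m, 0 < m ∧
      ∀ y ∈ Metric.sphere x ε ∩ closedHull (‖lam‖ ^ 2) (‖rho‖ ^ 2), m ≤ G y := by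
    refine hcomp.exists_forall_le' hGc.continuousOn fun y hy => ?_
    refine lt_of_le_of_ne (by positivity) fun h0 => ?_
    have hF : (reducedEnergy α γ y - reducedEnergy α γ x) ^ 2 = 0 := by
      linarith [sq_nonneg (reducedEnergy α γ y - reducedEnergy α γ x),
        sq_nonneg (secondIntegral α γ y - secondIntegral α γ x)]
    have hJ : (secondIntegral α γ y - secondIntegral α γ x) ^ 2 = 0 := by
      linarith [sq_nonneg (reducedEnergy α γ y - reducedEnergy α γ x),
        sq_nonneg (secondIntegral α γ y - secondIntegral α γ x)]
    have hyx : y = x := (hball (Metric.sphere_subset_closedBall hy.1)).2 hy.2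
      (sub_eq_zero.1 (pow_eq_zero_iff two_ne_zero |>.1 hF))
      (sub_eq_zero.1 (pow_eq_zero_iff two_ne_zero |>.1 hJ))
    have := hy.1
    rw [hyx, Metric.mem_sphere, dist_self] at this
    exact hε.ne this
  have hGx : G x < m := by simpa [hG] using hm
  refine ⟨{y | G y < m} ∩ Metric.ball x ε, Filter.inter_mem
    ((isOpen_lt hGc continuous_const).mem_nhds hGx) (Metric.ball_mem_nhds x hε), ?_⟩
  intro T c hT hc h0 t ht
  by_contra hU'
  have hfar : ε ≤ dist (c t) x := by
    by_contra! hlt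
    exact hU' (hball (Metric.ball_subset_closedBall hlt)).1
  have hcont : ContinuousOn (fun s => dist (c s) x) (Set.Icc 0 t) := by
    have : ContinuousOn c (Set.Icc 0 t) := fun s hs =>
      ((hc s ⟨hs.1, hs.2.trans ht.2⟩).2.continuousWithinAt).mono (Set.Icc_subset_Icc_right ht.2)
    exact continuous_dist.comp_continuousOn (this.prodMk continuousOn_const)
  obtain ⟨s, hs, hds⟩ := intermediate_value_Icc ht.1 hcont ⟨(Metric.mem_ball.1 h0.2).le, hfar⟩
  have hsT : s ∈ Set.Icc 0 T := ⟨hs.1, hs.2.trans ht.2⟩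
  have hle := hmG (c s) ⟨hds, fullReducedSpace_subset_closedHull _ _ (hc s hsT).1⟩
  have heq : G (c s) = G (c 0) := by
    simp only [hG, hc.reducedEnergy_eq hsT, hc.secondIntegral_eq hsT]
  have : G (c 0) < m := h0.1
  linarith

/-! ### The Casimirs in adapted variables -/

theorem C2_eq {x : Coord} (h : C1 x = 1) :
    C2 x = (k13 x + k23 x) ^ 2 - (k13 x - k23 x) ^ 2 - rr x ^ 2 * C3 x
      + 2 * rr x * momentumPairing x + (k11 x + k22 x - 2 * k12 x) * (1 - rr x ^ 2) := by
  simp only [C1] at h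
  simp only [C2, C3, momentumPairing]
  linear_combination (k11 x + k22 x - 2 * k12 x) * h

theorem C2_mul_C3_sub_sq {x : Coord} (h : C1 x = 1) (hg : gramRelation x = 0) :
    C2 x * C3 x - momentumPairing x ^ 2 =
      (k13 x + k23 x) ^ 2 * (C3 x + (k11 x + k22 x - 2 * k12 x))
      - 2 * (k11 x - k22 x) * (k13 x + k23 x) * (k13 x - k23 x)
      + (1 - rr x ^ 2) * (k11 x - k22 x) ^ 2 := by
  have h33 : k33 x = 1 - rr x ^ 2 := by simp only [C1] at h; linarith
  simp only [gramRelation, Matrix.det_fin_three, Matrix.of_apply, Matrix.cons_val, h33] at hg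
  rw [C2_eq h]
  simp only [C3, momentumPairing]
  linear_combination -4 * hg

theorem ext_of_adapted {x y : Coord} (hr : rr y = rr x) (hP : k13 y + k23 y = k13 x + k23 x)
    (hE : k13 y - k23 y = k13 x - k23 x) (hY : k11 y - k22 y = k11 x - k22 x)
    (hX : momentumPairing y = momentumPairing x) (hk : k12 y = k12 x) (h1 : C1 y = C1 x)
    (h3 : C3 y = C3 x) : y = x := by
  have hdel : del y = del x := by
    simp only [momentumPairing, hr, h3] at hX
    linarith
  simp only [C1, C3, hr, hk] at h1 h3
  funext i
  fin_cases i
  · change k11 y = k11 x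
    linarith
  · exact hk
  · change k13 y = k13 x
    linarith
  · change k22 y = k22 x
    linarith
  · change k23 y = k23 x
    linarith
  · change k33 y = k33 x
    linarith
  · exact hr
  · exact hdel

/-! ### Relative equilibria -/

theorem reducedField_eq_zero {α γ : ℝ} (hα : 0 < α) (hγ : 0 < γ) {x : Coord}
    (h : reducedField α γ x = 0) :
    k13 x = 0 ∧ k23 x = 0 ∧ rr x * (k11 x - k22 x) = 0 ∧
      α * del x = -γ * k33 x - α * rr x * (k11 x - k12 x) := by
  have e0 : -2 * γ * k13 x = 0 := congrFun h 0
  have e3 : 2 * γ * k23 x = 0 := congrFun h 3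
  have e2 : -γ * k33 x - α * rr x * (k11 x - k12 x) - α * del x = 0 := congrFun h 2
  have e4 : γ * k33 x - α * rr x * (k12 x - k22 x) + α * del x = 0 := congrFun h 4
  refine ⟨?_, ?_, ?_, by linarith⟩
  · exact (mul_eq_zero.1 e0).resolve_left (by linarith)
  · exact (mul_eq_zero.1 e3).resolve_left (by linarith)
  · refine (mul_eq_zero.1 (?_ : α * (rr x * (k11 x - k22 x)) = 0)).resolve_left hα.ne'
    linear_combination -e2 - e4

/-- The equilibrium condition in adapted variables. It says that, once the value of
`momentumPairing` is frozen, the cubic in `r` expressing `E²` has a double root. -/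
theorem mul_momentumPairing {α γ : ℝ} (hα : 0 < α) (hγ : 0 < γ) {x : Coord}
    (h : reducedField α γ x = 0) (h1 : C1 x = 1) :
    α * momentumPairing x = α * rr x * (C3 x + (k11 x + k22 x - 2 * k12 x))
      + 2 * γ * (1 - rr x ^ 2) := by
  obtain ⟨-, -, hY, hd⟩ := reducedField_eq_zero hα hγ h
  simp only [C1] at h1
  simp only [momentumPairing]
  linear_combination -2 * hd + 2 * γ * h1 + α * hY

/-! ### Instability of the upright equilibria -/

/-- The derivative of a map along a line on which the map is quadratic. -/
theorem fderiv_apply_of_quadratic {f : Coord → ℝ} {x v : Coord} (b e : ℝ)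
    (hf : DifferentiableAt ℝ f x) (h : ∀ t : ℝ, f (x + t • v) = f x + t * b + t ^ 2 * e) :
    fderiv ℝ f x v = b := by
  refine hf.lineDeriv_eq_fderiv.symm.trans (HasDerivAt.deriv ?_)
  rw [funext h]
  refine ((((hasDerivAt_id (0 : ℝ)).mul_const b).const_add (f x)).add
    (((hasDerivAt_id (0 : ℝ)).pow 2).mul_const e)).congr_deriv ?_
  simp

theorem differentiable_reducedField_apply (α γ : ℝ) (i : Fin 8) :
    Differentiable ℝ fun x => reducedField α γ x i := by
  have h (i : Fin 8) : Differentiable ℝ fun x : Coord => x i := differentiable_apply i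
  fin_cases i <;> simp only [reducedField, k11, k12, k13, k22, k23, k33, rr, del, Fin.zero_eta,
    Fin.mk_one, Fin.reduceFinMk, Matrix.cons_val] <;> fun_prop

/-- The candidate eigenvector: it lies in the `(Y, P)`-plane, `Y = k₁₁ - k₂₂` and
`P = k₁₃ + k₂₃`. -/
def unstableDirection (γ μ : ℝ) : Coord := ![2 * γ, 0, -μ, -2 * γ, -μ, 0, 0, 0]

theorem linearization_mulVec_unstableDirection {α γ μ : ℝ} {x : Coord} (h13 : k13 x = 0)
    (h23 : k23 x = 0) (hY : k11 x = k22 x) (hμ : μ * μ = 2 * α * γ * rr x) :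
    (linearization α γ x).mulVec (unstableDirection γ μ) = μ • unstableDirection γ μ := by
  rw [linearization, LinearMap.toMatrix'_mulVec]
  have hd : DifferentiableAt ℝ (reducedField α γ) x :=
    differentiableAt_pi.2 fun i => (differentiable_reducedField_apply α γ i).differentiableAt
  funext i
  change fderiv ℝ (reducedField α γ) x (unstableDirection γ μ) i = _
  rw [show fderiv ℝ (reducedField α γ) x (unstableDirection γ μ) i
    = fderiv ℝ (fun y => reducedField α γ y i) x (unstableDirection γ μ) by
      rw [fderiv_apply hd]; rfl]
  refine fderiv_apply_of_quadratic _ ((Pi.single 7 (4 * α * γ * μ) : Coord) i)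
    (differentiable_reducedField_apply α γ i).differentiableAt fun t => ?_
  simp only [k11, k13, k22, k23, rr] at h13 h23 hY hμ
  fin_cases i <;> simp [reducedField, unstableDirection, k11, k12, k13, k22, k23, k33, rr, del,
    h13, h23, hY]
  · ring
  · linear_combination t * hμ
  · ring
  · linear_combination t * hμ
  · ring

theorem unstableDirection_mem_tangentSpace {γ μ : ℝ} {x : Coord} (h13 : k13 x = 0)
    (h23 : k23 x = 0) (hY : k11 x = k22 x) : unstableDirection γ μ ∈ tangentSpace x := by
  have h (i : Fin 8) : Differentiable ℝ fun x : Coord => x i := differentiable_apply i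
  simp only [k11, k13, k22, k23] at h13 h23 hY
  simp only [tangentSpace, Submodule.mem_inf, LinearMap.mem_ker, ContinuousLinearMap.coe_coe]
  refine ⟨⟨⟨?_, ?_⟩, ?_⟩, ?_⟩
  · refine fderiv_apply_of_quadratic 0 0 ?_ fun t => ?_
    · unfold C1 k33 rr
      fun_prop
    · simp [C1, k33, rr, unstableDirection]
  · refine fderiv_apply_of_quadratic 0 (4 * μ ^ 2) ?_ fun t => ?_
    · unfold C2 k11 k12 k13 k22 k23 k33 rr del
      fun_prop
    · simp [C2, k11, k12, k13, k22, k23, k33, rr, del, unstableDirection, h13, h23, hY]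
      ring
  · refine fderiv_apply_of_quadratic 0 0 ?_ fun t => ?_
    · unfold C3 k11 k12 k22
      fun_prop
    · simp [C3, k11, k12, k22, unstableDirection]
      ring
  · refine fderiv_apply_of_quadratic 0
      (4 * γ ^ 2 * x 5 + 2 * μ ^ 2 * x 3 - 2 * μ ^ 2 * x 1) ?_ fun t => ?_
    · unfold gramRelation
      simp only [Matrix.det_fin_three, k11, k12, k13,
        k22, k23, k33, del, Matrix.of_apply, Matrix.cons_val]
      fun_prop
    · simp only [gramRelation, Matrix.det_fin_three, k11, k12, k13, k22, k23, k33, del,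
        Matrix.of_apply, Matrix.cons_val]
      simp [unstableDirection, h13, h23, hY]
      ring

theorem linearlyUnstable_of_rr_pos {α γ : ℝ} (hα : 0 < α) (hγ : 0 < γ) {x : Coord}
    (h : reducedField α γ x = 0) (hr : 0 < rr x) : LinearlyUnstable α γ x := by
  obtain ⟨h13, h23, hY, -⟩ := reducedField_eq_zero hα hγ h
  have hY' : k11 x = k22 x := sub_eq_zero.1 ((mul_eq_zero.1 hY).resolve_left hr.ne')
  have hpos : 0 < 2 * α * γ * rr x := by positivity
  set μ := Real.sqrt (2 * α * γ * rr x)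
  have hμ : μ * μ = 2 * α * γ * rr x := Real.mul_self_sqrt hpos.le
  refine ⟨(μ : ℂ), fun i => (unstableDirection γ μ i : ℂ), ?_, ?_, ?_, ?_⟩
  · exact Real.sqrt_pos.2 hpos
  · rw [Module.End.hasEigenvector_iff, Module.End.mem_eigenspace_iff]
    refine ⟨?_, fun h0 => ?_⟩
    · rw [Matrix.toLin'_apply]
      have e := linearization_mulVec_unstableDirection h13 h23 hY' hμ
      funext i
      have e' := (Complex.ofRealHom.map_mulVec (linearization α γ x) (unstableDirection γ μ) i).symm
      refine e'.trans ?_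
      rw [e]
      simp
    · have := congrFun h0 0
      simp [unstableDirection] at this
      exact hγ.ne' this
  · simpa using unstableDirection_mem_tangentSpace h13 h23 hY'
  · exact Submodule.zero_mem (tangentSpace x)

/-! ### Isolation of the hanging and of the horizontal equilibria -/

theorem continuous_momentumPairing : Continuous momentumPairing := by
  have h (i : Fin 8) : Continuous fun x : Coord => x i := continuous_apply i
  unfold momentumPairing C3 rr k11 k12 k22 del
  fun_prop

/-- The consequences of the conservation laws: `|D|²` is an affine function of `r`, and `⟨S, D⟩²`
one of the momentum pairing. -/
theorem eq_of_integrals_eq {α γ : ℝ} (hα : 0 < α) {x y : Coord} (h3 : C3 y = C3 x)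
    (hF : reducedEnergy α γ y = reducedEnergy α γ x)
    (hJ : secondIntegral α γ y = secondIntegral α γ x) :
    k11 y + k22 y - 2 * k12 y
        = k11 x + k22 x - 2 * k12 x - 4 * γ / α * (rr y - rr x) ∧
      (k11 y - k22 y) ^ 2
        = (k11 x - k22 x) ^ 2 - 4 * γ / α * (momentumPairing y - momentumPairing x) := by
  simp only [reducedEnergy, secondIntegral, C3] at *
  constructor
  · field_simp
    linear_combination α * h3 + 4 * hF
  · field_simp
    linear_combination hJ

theorem k12_eq_of_reducedEnergy_eq {α γ : ℝ} (hα : 0 < α) {x y : Coord} (hr : rr y = rr x)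
    (hF : reducedEnergy α γ y = reducedEnergy α γ x) : k12 y = k12 x := by
  simp only [reducedEnergy, hr] at hF
  exact mul_left_cancel₀ hα.ne' (by linarith)

theorem momentumPairing_eq {α γ : ℝ} (hα : 0 < α) (hγ : 0 < γ) {x : Coord}
    (h : reducedField α γ x = 0) (h1 : C1 x = 1) :
    momentumPairing x = rr x * (C3 x + (k11 x + k22 x - 2 * k12 x))
      + 4 * γ / α / 2 * (1 - rr x ^ 2) := by
  have := mul_momentumPairing hα hγ h h1
  field_simp
  linear_combination 2 * this

theorem eventually_pos {f : Coord → ℝ} (hf : Continuous f) {x : Coord} (h : 0 < f x) :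
    ∀ᶠ y in 𝓝 x, 0 < f y :=
  hf.continuousAt.eventually_const_lt h

theorem isolated_of_hanging {α γ : ℝ} (hα : 0 < α) (hγ : 0 < γ) {a b : ℝ} (hb : 0 ≤ b)
    {x : Coord} (hx : x ∈ closedHull a b) (h : reducedField α γ x = 0) (hr : rr x < 0) :
    ∀ᶠ y in 𝓝 x, y ∈ closedHull a b → reducedEnergy α γ y = reducedEnergy α γ x →
      secondIntegral α γ y = secondIntegral α γ x → y = x := by
  obtain ⟨h13, h23, hY, -⟩ := reducedField_eq_zero hα hγ h
  have hY₀ : k11 x - k22 x = 0 := (mul_eq_zero.1 hY).resolve_left hr.ne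
  obtain ⟨x1, x2, x3, xg, hd₀, -, -⟩ := hx
  have hX := momentumPairing_eq hα hγ h x1
  have rel1 := C2_eq x1
  have rel2 := C2_mul_C3_sub_sq x1 xg
  rw [h13, h23, x2, x3] at rel1
  rw [h13, h23, hY₀, x2, x3] at rel2
  rw [x3] at hX
  have hi (i : Fin 8) : Continuous fun x : Coord => x i := continuous_apply i
  have hXc := continuous_momentumPairing
  have hκ : 0 < 4 * γ / α := by positivity
  -- The step that needs the sign of `r`: no displacement in the variables `P` and `Y`.
  have hPY : ∀ᶠ y in 𝓝 x, y ∈ closedHull a b → reducedEnergy α γ y = reducedEnergy α γ x →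
      secondIntegral α γ y = secondIntegral α γ x →
      k13 y + k23 y = 0 ∧ k11 y - k22 y = 0 := by
    rcases (add_nonneg hb hd₀).eq_or_lt with hm | hm
    · -- Here `R₁ + R₂ = 0` on the whole reduced space.
      have hb0 : b = 0 := by linarith
      refine .of_forall fun y ⟨_, _, y3, _, _, hP, hYd⟩ _ _ => ?_
      rw [y3, hb0, zero_mul] at hP hYd
      exact ⟨pow_eq_zero_iff two_ne_zero |>.1 (le_antisymm hP (sq_nonneg _)),
        pow_eq_zero_iff two_ne_zero |>.1 (le_antisymm hYd (sq_nonneg _))⟩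
    · have e1 : ∀ᶠ y in 𝓝 x, 0 < b + (k11 y + k22 y - 2 * k12 y) := by
        refine eventually_pos ?_ hm
        unfold k11 k12 k22
        fun_prop
      have e2 : ∀ᶠ y in 𝓝 x, 0 < -(momentumPairing x + momentumPairing y
          - 4 * γ / α * (1 - rr y ^ 2)) * (b + (k11 y + k22 y - 2 * k12 y))
          - 4 * γ / α * (k13 y - k23 y) ^ 2 := by
        refine eventually_pos ?_ ?_
        · unfold k11 k12 k22 k13 k23 rr
          fun_prop
        · rw [h13, h23]
          have : 0 < -rr x * (b + (k11 x + k22 x - 2 * k12 x)) ^ 2 :=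
            mul_pos (by linarith) (by positivity)
          rw [hX]
          linarith
      filter_upwards [e1, e2] with y hn hq hy hF hJ
      obtain ⟨y1, y2, y3, yg, -, -, -⟩ := hy
      obtain ⟨-, hYy⟩ := eq_of_integrals_eq hα (y3.trans x3.symm) hF hJ
      have s2 := C2_mul_C3_sub_sq y1 yg
      rw [y2, y3] at s2
      rw [hY₀] at hYy
      generalize k11 y + k22 y - 2 * k12 y = d at *
      generalize k11 y - k22 y = Y at *
      generalize k13 y + k23 y = P at *
      generalize k13 y - k23 y = E at *
      generalize momentumPairing y = X at *
      generalize momentumPairing x = X₀ at *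
      generalize 4 * γ / α = κ at *
      -- The completed square of the form in `(P, Y)`, after `X₀ - X` is replaced by `Y² / κ`.
      have sum : ((b + d) * P - E * Y) ^ 2 * κ
          + (-(X₀ + X - κ * (1 - rr y ^ 2)) * (b + d) - κ * E ^ 2) * Y ^ 2 = 0 := by
        linear_combination (b + d) * κ * (rel2 - s2) -
          (b + d) * (X₀ + X) * hYy
      have t1 := mul_nonneg (sq_nonneg ((b + d) * P - E * Y)) hκ.le
      have t2 := mul_nonneg hq.le (sq_nonneg Y)
      have hY0 : Y = 0 := by
        refine pow_eq_zero_iff two_ne_zero |>.1 ((mul_eq_zero.1 (?_ : _ * Y ^ 2 = 0)).resolve_left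
          hq.ne')
        linarith
      have hP0 : ((b + d) * P - E * Y) = 0 := by
        refine pow_eq_zero_iff two_ne_zero |>.1
          ((mul_eq_zero.1 (?_ : _ * κ = 0)).resolve_right hκ.ne')
        linarith
      rw [hY0, mul_zero, sub_zero] at hP0
      exact ⟨(mul_eq_zero.1 hP0).resolve_left hn.ne', hY0⟩
  have hcub : ∀ᶠ y in 𝓝 x,
      0 < b + (k11 x + k22 x - 2 * k12 x) - 4 * γ / α * (rr y + rr x) := by
    refine eventually_pos ?_ ?_
    · unfold rr
      fun_prop
    · have := mul_neg_of_pos_of_neg hκ hr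
      linarith
  filter_upwards [hPY, hcub] with y hPYy hpos hy hF hJ
  obtain ⟨hP0, hY0⟩ := hPYy hy hF hJ
  obtain ⟨y1, y2, y3, -, -, -, -⟩ := hy
  obtain ⟨hd, hYy⟩ := eq_of_integrals_eq hα (y3.trans x3.symm) hF hJ
  have s1 := C2_eq y1
  have hXX : momentumPairing y = momentumPairing x := by
    rw [hY0, hY₀] at hYy
    refine sub_eq_zero.1 ((mul_eq_zero.1 (?_ : 4 * γ / α * _ = 0)).resolve_left hκ.ne')
    linarith
  rw [y2, y3, hP0, hXX, hd] at s1
  -- The cubic in `r` with its double root factored out.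
  have fac : (k13 y - k23 y) ^ 2 = -((rr y - rr x) ^ 2
      * (b + (k11 x + k22 x - 2 * k12 x) - 4 * γ / α * (rr y + rr x))) := by
    linear_combination s1 - rel1 + 2 * (rr y - rr x) * hX
  have hrr : rr y = rr x := by
    by_contra hne
    have : 0 < (rr y - rr x) ^ 2 := by
      have := sub_ne_zero.2 hne
      positivity
    linarith [mul_pos this hpos, sq_nonneg (k13 y - k23 y)]
  have hE : k13 y - k23 y = 0 := by
    rw [hrr, sub_self] at fac
    simpa using fac
  exact ext_of_adapted hrr (by linarith) (by linarith) (by linarith) hXX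
    (k12_eq_of_reducedEnergy_eq hα hrr hF) (y1.trans x1.symm) (y3.trans x3.symm)

theorem isolated_of_horizontal {α γ : ℝ} (hα : 0 < α) (hγ : 0 < γ) {a b : ℝ} (hb : 0 ≤ b)
    {x : Coord} (hx : x ∈ closedHull a b) (h : reducedField α γ x = 0) (hr : rr x = 0)
    (hiso : ¬ IsIsosceles x) :
    ∀ᶠ y in 𝓝 x, y ∈ closedHull a b → reducedEnergy α γ y = reducedEnergy α γ x →
      secondIntegral α γ y = secondIntegral α γ x → y = x := by
  obtain ⟨h13, h23, -, -⟩ := reducedField_eq_zero hα hγ h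
  obtain ⟨x1, x2, x3, xg, hd₀, -, -⟩ := hx
  have hX := momentumPairing_eq hα hγ h x1
  have rel1 := C2_eq x1
  have rel2 := C2_mul_C3_sub_sq x1 xg
  rw [h13, h23, x2, x3, hr] at rel1
  rw [h13, h23, x2, x3, hr] at rel2
  rw [x3, hr] at hX
  have hi (i : Fin 8) : Continuous fun x : Coord => x i := continuous_apply i
  have hκ : 0 < 4 * γ / α := by positivity
  have hY₀ : k11 x - k22 x ≠ 0 := sub_ne_zero.2 hiso
  have hX₀ : 0 < momentumPairing x ^ 2 := by
    rw [hX]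
    positivity
  have hdisc : 0 < (b + (k11 x + k22 x - 2 * k12 x)) ^ 2 - 4 * (k11 x - k22 x) ^ 2 := by
    have : b * (k11 x + k22 x - 2 * k12 x) = momentumPairing x ^ 2 + (k11 x - k22 x) ^ 2 := by
      linear_combination rel2 - b * rel1
    linarith [sq_nonneg (b - (k11 x + k22 x - 2 * k12 x))]
  have hm : 0 < b + (k11 x + k22 x - 2 * k12 x) := by
    refine (add_nonneg hb hd₀).lt_of_ne fun h0 => ?_
    rw [← h0] at hdisc
    linarith [sq_nonneg (k11 x - k22 x)]
  have e1 : ∀ᶠ y in 𝓝 x, 0 < b + (k11 y + k22 y - 2 * k12 y) := by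
    refine eventually_pos ?_ hm
    unfold k11 k12 k22
    fun_prop
  have e2 : ∀ᶠ y in 𝓝 x,
      0 < (b + (k11 y + k22 y - 2 * k12 y)) ^ 2 - 4 * (k11 y - k22 y) ^ 2 := by
    refine eventually_pos ?_ hdisc
    unfold k11 k12 k22
    fun_prop
  have e3 : ∀ᶠ y in 𝓝 x, 0 < ((k11 y - k22 y) + (k11 x - k22 x)) ^ 2 := by
    refine eventually_pos ?_ ?_
    · unfold k11 k22
      fun_prop
    · exact sq_pos_iff.2 fun h0 => hY₀ (by linarith)
  filter_upwards [e1, e2, e3] with y hn hq hYne hy hF hJ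
  obtain ⟨y1, y2, y3, yg, -, -, -⟩ := hy
  obtain ⟨hd, hYy⟩ := eq_of_integrals_eq hα (y3.trans x3.symm) hF hJ
  have s1 := C2_eq y1
  have s2 := C2_mul_C3_sub_sq y1 yg
  rw [y2, y3] at s1 s2
  rw [hr] at hd
  have main : rr y = 0 ∧ k13 y + k23 y = 0 ∧ k13 y - k23 y = 0
      ∧ momentumPairing y = momentumPairing x := by
    generalize k11 x + k22 x - 2 * k12 x = d₀ at *
    generalize k11 y + k22 y - 2 * k12 y = d at *
    generalize k11 y - k22 y = Y at *
    generalize k11 x - k22 x = Y₀ at *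
    generalize k13 y + k23 y = P at *
    generalize k13 y - k23 y = E at *
    generalize momentumPairing y = X at *
    generalize momentumPairing x = X₀ at *
    generalize 4 * γ / α = κ at *
    generalize rr y = r at *
    -- `2 (b + d)` times the sum of the relation of `C2_mul_C3_sub_sq` and `(b + d) / 2` times that
    -- of `C2_eq`, each taken relative to the equilibrium, with the squares completed.
    have sum : ((b + d) * P - 2 * Y * E) ^ 2 + ((b + d) ^ 2 - 4 * Y ^ 2) * E ^ 2
        + 2 * (b + d) * (X - X₀ - (b + d) * r / 2) ^ 2
        + ((b + d) ^ 2 - 4 * Y ^ 2) * ((b + d) / 2 * r ^ 2) = 0 := by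
      linear_combination (b + d) ^ 2 * (s1 - rel1 + 2 * r * hX + hd)
        + 2 * (b + d) * (rel2 - s2 - 2 * (X - X₀) * hX - hYy)
    have t1 := sq_nonneg ((b + d) * P - 2 * Y * E)
    have t2 := mul_nonneg hq.le (sq_nonneg E)
    have t3 := mul_nonneg (by linarith : 0 ≤ 2 * (b + d))
      (sq_nonneg (X - X₀ - (b + d) * r / 2))
    have t4 := mul_nonneg hq.le (mul_nonneg (half_pos hn).le (sq_nonneg r))
    have hr0 : r = 0 := by
      refine pow_eq_zero_iff two_ne_zero |>.1 ((mul_eq_zero.1 ((mul_eq_zero.1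
        (?_ : _ * ((b + d) / 2 * r ^ 2) = 0)).resolve_left hq.ne')).resolve_left (half_pos hn).ne')
      linarith
    have hE0 : E = 0 := by
      refine pow_eq_zero_iff two_ne_zero |>.1 ((mul_eq_zero.1
        (?_ : _ * E ^ 2 = 0)).resolve_left hq.ne')
      linarith
    have hP0 : (b + d) * P - 2 * Y * E = 0 := pow_eq_zero_iff two_ne_zero |>.1 (by linarith)
    have hX0 : X - X₀ - (b + d) * r / 2 = 0 := by
      refine pow_eq_zero_iff two_ne_zero |>.1 ((mul_eq_zero.1
        (?_ : 2 * (b + d) * _ = 0)).resolve_left (by linarith))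
      linarith
    rw [hE0, mul_zero, sub_zero] at hP0
    rw [hr0] at hX0
    exact ⟨hr0, (mul_eq_zero.1 hP0).resolve_left hn.ne', hE0, by linarith⟩
  obtain ⟨hr0, hP0, hE0, hXX⟩ := main
  have hYY : k11 y - k22 y = k11 x - k22 x := by
    rw [hXX] at hYy
    refine sub_eq_zero.1 ((mul_eq_zero.1 (?_ : ((k11 y - k22 y) + (k11 x - k22 x)) * _ = 0)
      ).resolve_left (pow_ne_zero_iff two_ne_zero |>.1 hYne.ne'))
    linear_combination hYy
  have hrr : rr y = rr x := hr0.trans hr.symm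
  exact ext_of_adapted hrr (by linarith) (by linarith) hYY hXX
    (k12_eq_of_reducedEnergy_eq hα hrr hF) (y1.trans x1.symm) (y3.trans x3.symm)

end LagrangeTop

theorem mainTheorem2 (α γ : ℝ) (hα : 0 < α) (hγ : 0 < γ)
    (lam rho : ℍ[ℝ]) (hlam : lam.re = 0) (hrho : rho.re = 0)
    (x : LagrangeTop.Coord) (hx : LagrangeTop.IsRelativeEquilibrium α γ lam rho x) :
    (LagrangeTop.theta x < Real.pi / 2 → LagrangeTop.LinearlyUnstable α γ x) ∧
    (Real.pi / 2 < LagrangeTop.theta x → LagrangeTop.LyapunovStable α γ lam rho x) ∧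
    (LagrangeTop.theta x = Real.pi / 2 → ¬ LagrangeTop.IsIsosceles x →
      LagrangeTop.LyapunovStable α γ lam rho x) := by
  obtain ⟨hM, h0⟩ := hx
  have hc := LagrangeTop.fullReducedSpace_subset_closedHull lam rho hM
  refine ⟨fun hθ => ?_, fun hθ => ?_, fun hθ hiso => ?_⟩
  · exact LagrangeTop.linearlyUnstable_of_rr_pos hα hγ h0 (Real.arccos_lt_pi_div_two.1 hθ)
  · have hr : LagrangeTop.rr x < 0 := by
      by_contra! hr
      exact hθ.not_ge (Real.arccos_le_pi_div_two.2 hr)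
    exact LagrangeTop.lyapunovStable_of_isolated
      (LagrangeTop.isolated_of_hanging hα hγ (sq_nonneg _) hc h0 hr)
  · exact LagrangeTop.lyapunovStable_of_isolated
      (LagrangeTop.isolated_of_horizontal hα hγ (sq_nonneg _) hc h0
        (Real.arccos_eq_pi_div_two.1 hθ) hiso)
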